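/- For a finite simple graph $\mathcal{G}$ with vertex set $V$ and edge set $E$ let $$\mathrm{cox}(\mathcal{G}) = \langle \sigma_v,\ v\in V \mid \sigma_v^2=e\ \ \forall v\in V,\ [\sigma_v,\sigma_w]=e\ \ \forall \{v,w\}\in E\rangle$$ be the associated right-angled Coxeter group. For an integer $r\ge 0$ let $\mathcal{A}_r$ be the graph obtained from the complete graph on $r$ vertices by adding two vertices, each joined by an edge to every vertex of the complete graph but not joined to each other. For a group $G$ and an integer $n\ge 1$ let $s_n(G)$ denote the number of subgroups of $G$ of index $n$. Let $r\ge 0$ be an integer, let $\Gamma=\mathrm{cox}(\mathcal{A}_r)$, and write $s_{2^j}=s_{2^j}((\mathbb{Z}/2\mathbb{Z})^r)$ for the number of index $2^j$ subgroups of $(\mathbb{Z}/2\mathbb{Z})^r$. Then $$s_{2^j}=\frac{\prod_{l=0}^{j-1}(2^r-2^l)}{\prod_{l=0}^{j-1}(2^j-2^l)}\qquad\text{for all } 0\le j\le r,$$ and for every integer $n\ge 1$, $$s_n(\Gamma) = n\left(1+\sum_{\substack{0<j\le r\\ 2^j\mid n}} 2^j\, s_{2^j}\right)+\sum_{\substack{0\le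 j\le r\\ 2^{j+1}\mid n}} 2^j\, s_{2^j}.$$ -/

import Mathlib

/-- The defining relators of the right-angled Coxeter group of a graph: `σ_v ^ 2` for every vertex
`v`, and the commutator `[σ_v, σ_w] = σ_v σ_w σ_v⁻¹ σ_w⁻¹` for every edge `{v, w}`. -/
def racgRels {V : Type*} (G : SimpleGraph V) : Set (FreeGroup V) :=
  {x | ∃ v, x = FreeGroup.of v ^ 2} ∪
    {x | ∃ v w, G.Adj v w ∧
      x = FreeGroup.of v * FreeGroup.of w * (FreeGroup.of v)⁻¹ * (FreeGroup.of w)⁻¹}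

/-- The right-angled Coxeter group `cox(G)`. -/
abbrev Cox {V : Type*} (G : SimpleGraph V) : Type _ := PresentedGroup (racgRels G)

/-- The graph `𝒜_r`: the complete graph on the `r` vertices `Sum.inl i`, together with two further
vertices `Sum.inr 0`, `Sum.inr 1`, each joined to all the `Sum.inl i` but not to one another. -/
def suspensionGraph (r : ℕ) : SimpleGraph (Fin r ⊕ Fin 2) where
  Adj u v := u ≠ v ∧ ¬ (u.isRight ∧ v.isRight)
  symm := ⟨fun _ _ h => ⟨h.1.symm, fun h' => h.2 h'.symm⟩⟩
  loopless := ⟨fun _ h => h.1 rfl⟩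

/-- `s_n(G)`: the number of subgroups of index `n` of the group `G`. (For `n ≥ 1` and `G` finitely
generated there are finitely many of these.) -/
noncomputable def subgroupCount (G : Type*) [Group G] (n : ℕ) : ℕ :=
  Nat.card {H : Subgroup G // H.index = n}

/-- The group `(ℤ/2ℤ)^r`, written multiplicatively. -/
abbrev ElemAb (r : ℕ) : Type := Fin r → Multiplicative (ZMod 2)

/-! The graph is a join of a complete graph and two isolated points, so the group is `A × D` with `A
= (ℤ/2)^r` and `D` infinite dihedral (`coxEquiv`). As `A` is abelian, Goursat's lemma takes a simple
form: a subgroup `H` of `A × D` is the same as `B = H ∩ A`, the projection `K` of `H` to `D`, and an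
arbitrary homomorphism `K → A/B`; its index is `[A : B] [D : K]` (`bijective_fibreSubgroup`,
`index_fibreSubgroup`).

Fix `B` of index `2^j` and put `Q = A/B`, `n = 2^j m`. The index-`m` subgroups of `D` are `m`
infinite dihedral ones, each with `|Q|^2` homomorphisms to `Q` (the images of two involutions are
free, since `Q` has exponent two), and, for `m` even, one infinite cyclic one with `|Q|`
homomorphisms. So `B` contributes `m 4^j = n 2^j`, plus `2^j` if `2^(j+1) ∣ n`. Summing over `B`
gives the formula; its leading `1` is the term `j = 0`.

The values `s_{2^j}` count subspaces of codimension `j` in `𝔽₂^r`; duality turns these into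
subspaces of dimension `j`, which are counted through their ordered bases. -/

/-! ### Goursat's lemma for a product with an abelian factor -/

section ProductSubgroups

variable {A D : Type*} [CommGroup A] [Group D]

/-- The subgroup of `A × D` of all `(a, d)` with `d ∈ K` and `a B = φ d`. -/
def fibreSubgroup (B : Subgroup A) (K : Subgroup D) (φ : K →* A ⧸ B) : Subgroup (A × D) :=
  (((QuotientGroup.mk' B).comp (MonoidHom.fst A K)) / (φ.comp (MonoidHom.snd A K))).ker.map
    ((MonoidHom.id A).prodMap K.subtype)

theorem mem_fibreSubgroup {B : Subgroup A} {K : Subgroup D} {φ : K →* A ⧸ B} {a : A} {d : D} :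
    (a, d) ∈ fibreSubgroup B K φ ↔ ∃ h : d ∈ K, (a : A ⧸ B) = φ ⟨d, h⟩ := by
  simp only [fibreSubgroup, Subgroup.mem_map, MonoidHom.mem_ker, MonoidHom.div_apply, div_eq_one]
  constructor
  · rintro ⟨⟨a', k⟩, h, he⟩
    simp only [MonoidHom.coe_prodMap, Prod.map_apply, MonoidHom.id_apply, Subgroup.coe_subtype,
      Prod.mk.injEq] at he
    obtain ⟨rfl, rfl⟩ := he
    exact ⟨k.2, h⟩
  · rintro ⟨h, he⟩
    exact ⟨(a, ⟨d, h⟩), he, rfl⟩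

/-- Inside `A × K`, which has index `[D : K]`, this is the kernel of a homomorphism onto `A ⧸ B`,
already surjective on `A`. -/
theorem index_fibreSubgroup (B : Subgroup A) (K : Subgroup D) (φ : K →* A ⧸ B) :
    (fibreSubgroup B K φ).index = B.index * K.index := by
  have hinj : Function.Injective ((MonoidHom.id A).prodMap K.subtype) := by
    rw [MonoidHom.coe_prodMap]
    exact Function.Injective.prodMap Function.injective_id Subtype.val_injective
  have hrange : ((MonoidHom.id A).prodMap K.subtype).range = K.comap (MonoidHom.snd A D) := by
    ext ⟨a, d⟩
    simp [MonoidHom.mem_range, Subgroup.mem_prod]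
  rw [fibreSubgroup, Subgroup.index_map_of_injective _ hinj, hrange,
    Subgroup.index_comap_of_surjective _ Prod.snd_surjective, Subgroup.index_ker,
    MonoidHom.range_eq_top.mpr, Subgroup.card_top, ← Subgroup.index_eq_card]
  intro q
  obtain ⟨a, rfl⟩ := QuotientGroup.mk_surjective q
  exact ⟨(a, 1), by simp⟩

/-- For the inverse, the elements `a` with `(a, k) ∈ H` form a single coset of `H ∩ A`, and `φ k` is
that coset. -/
theorem bijective_fibreSubgroup :
    Function.Bijective fun x : (Σ B : Subgroup A, Σ K : Subgroup D, K →* A ⧸ B) ↦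
      fibreSubgroup x.1 x.2.1 x.2.2 := by
  constructor
  · rintro ⟨B, K, φ⟩ ⟨B', K', φ'⟩ h
    simp only at h
    have key : ∀ (a : A) (d : D), (∃ h : d ∈ K, (a : A ⧸ B) = φ ⟨d, h⟩) ↔
        ∃ h : d ∈ K', (a : A ⧸ B') = φ' ⟨d, h⟩ := fun a d ↦ by
      rw [← mem_fibreSubgroup, ← mem_fibreSubgroup, h]
    have hB : B = B' := by
      ext a
      have := key a 1
      have e : (⟨1, K.one_mem⟩ : K) = 1 := rfl
      have e' : (⟨1, K'.one_mem⟩ : K') = 1 := rfl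
      simpa [e, e', K.one_mem, K'.one_mem] using this
    have hK : K = K' := by
      ext d
      constructor
      · intro hd
        obtain ⟨a, ha⟩ := QuotientGroup.mk_surjective (φ ⟨d, hd⟩)
        exact ((key a d).1 ⟨hd, ha⟩).1
      · intro hd
        obtain ⟨a, ha⟩ := QuotientGroup.mk_surjective (φ' ⟨d, hd⟩)
        exact ((key a d).2 ⟨hd, ha⟩).1
    subst hB hK
    have : φ = φ' := by
      ext ⟨d, hd⟩
      obtain ⟨a, ha⟩ := QuotientGroup.mk_surjective (φ ⟨d, hd⟩)
      obtain ⟨_, ha'⟩ := (key a d).1 ⟨hd, ha⟩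
      rw [← ha, ← ha']
    rw [this]
  · intro H
    have hex : ∀ k : H.map (MonoidHom.snd A D), ∃ a : A, (a, (k : D)) ∈ H := by
      rintro ⟨_, ⟨a, d⟩, h, rfl⟩
      exact ⟨a, h⟩
    choose s hs using hex
    have huniq : ∀ (k : H.map (MonoidHom.snd A D)) (a : A), (a, (k : D)) ∈ H ↔
        (a : A ⧸ H.comap (MonoidHom.inl A D)) = s k := by
      intro k a
      rw [eq_comm, QuotientGroup.eq, Subgroup.mem_comap, MonoidHom.inl_apply]
      have e : ((s k)⁻¹ * a, (1 : D)) = (s k, (k : D))⁻¹ * (a, (k : D)) := by simp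
      rw [e, Subgroup.mul_mem_cancel_left _ (H.inv_mem (hs k))]
    refine ⟨⟨H.comap (MonoidHom.inl A D), H.map (MonoidHom.snd A D),
      MonoidHom.mk' (fun k ↦ (s k : A ⧸ H.comap (MonoidHom.inl A D))) fun k l ↦ ?_⟩, ?_⟩
    · rw [← QuotientGroup.mk_mul, eq_comm, ← huniq]
      exact H.mul_mem (hs k) (hs l)
    · ext ⟨a, d⟩
      rw [mem_fibreSubgroup]
      constructor
      · rintro ⟨h, he⟩
        exact (huniq ⟨d, h⟩ a).2 he
      · intro h
        exact ⟨⟨(a, d), h, rfl⟩, (huniq ⟨d, _⟩ a).1 h⟩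

/-- Subgroups of `A × D` of index `n`, sorted by their intersection with `A`. -/
noncomputable def prodSubgroupEquiv (n : ℕ) :
    {H : Subgroup (A × D) // H.index = n} ≃
      Σ B : Subgroup A, Σ K : {K : Subgroup D // B.index * K.index = n}, K.1 →* A ⧸ B :=
  ((Equiv.subtypeEquiv (Equiv.ofBijective _ bijective_fibreSubgroup)
    (p := fun x : (Σ B : Subgroup A, Σ K : Subgroup D, K →* A ⧸ B) ↦ x.1.index * x.2.1.index = n)
    (fun x ↦ by simp [index_fibreSubgroup])).symm).trans
  { toFun := fun x ↦ ⟨x.1.1, ⟨x.1.2.1, x.2⟩, x.1.2.2⟩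
    invFun := fun y ↦ ⟨⟨y.1, y.2.1.1, y.2.2⟩, y.2.1.2⟩
    left_inv := fun _ ↦ rfl
    right_inv := fun _ ↦ rfl }

end ProductSubgroups

theorem subgroupCount_congr {G G' : Type*} [Group G] [Group G'] (e : G ≃* G') (n : ℕ) :
    subgroupCount G n = subgroupCount G' n :=
  Nat.card_congr <| e.mapSubgroup.toEquiv.subtypeEquiv fun H ↦ by
    simp [Subgroup.index_map_equiv]
-- Splitting the Coxeter group as `(ℤ/2)^r × D_∞`
section CoxeterGroup

theorem cox_sq {V : Type*} (G : SimpleGraph V) (v : V) :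
    (PresentedGroup.of v : Cox G) * PresentedGroup.of v = 1 := by
  have : (PresentedGroup.mk (racgRels G) (FreeGroup.of v ^ 2)) = 1 :=
    PresentedGroup.one_of_mem (Or.inl ⟨v, rfl⟩)
  rwa [map_pow, pow_two] at this

theorem cox_commute {V : Type*} (G : SimpleGraph V) {v w : V} (h : G.Adj v w) :
    Commute (PresentedGroup.of v : Cox G) (PresentedGroup.of w) := by
  have : (PresentedGroup.mk (racgRels G)
      (FreeGroup.of v * FreeGroup.of w * (FreeGroup.of v)⁻¹ * (FreeGroup.of w)⁻¹)) = 1 :=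
    PresentedGroup.one_of_mem (Or.inr ⟨v, w, h, rfl⟩)
  rw [map_mul, map_mul, map_mul, map_inv, map_inv, mul_inv_eq_one, mul_inv_eq_iff_eq_mul] at this
  exact this

theorem suspensionGraph_adj_inl_inl {r : ℕ} {i j : Fin r} (h : i ≠ j) :
    (suspensionGraph r).Adj (Sum.inl i) (Sum.inl j) := by
  simp [suspensionGraph, h]

theorem suspensionGraph_adj_inl_inr {r : ℕ} (i : Fin r) (j : Fin 2) :
    (suspensionGraph r).Adj (Sum.inl i) (Sum.inr j) := by
  simp [suspensionGraph]

/-- The homomorphism from a group of order two given by an involution. -/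
def involutionHom {G : Type*} [Group G] (g : G) (hg : g * g = 1) : Multiplicative (ZMod 2) →* G :=
  AddMonoidHom.toMultiplicativeLeft (ZMod.lift 2 ⟨(zmultiplesHom (Additive G) (Additive.ofMul g)), by
    rw [zmultiplesHom_apply, natCast_zsmul, ← ofMul_pow, pow_two, hg, ofMul_one]⟩)

theorem involutionHom_ofAdd_one {G : Type*} [Group G] (g : G) (hg : g * g = 1) :
    involutionHom g hg (Multiplicative.ofAdd 1) = g := by
  have := ZMod.lift_coe 2 ⟨(zmultiplesHom (Additive G) (Additive.ofMul g)), by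
    rw [zmultiplesHom_apply, natCast_zsmul, ← ofMul_pow, pow_two, hg, ofMul_one]⟩ 1
  simp only [Int.cast_one] at this
  simp [involutionHom, this]

theorem multiplicative_zmod_two_cases (x : Multiplicative (ZMod 2)) :
    x = 1 ∨ x = Multiplicative.ofAdd 1 := by
  revert x; decide

theorem zpow_mul_of_involution {G : Type*} [Group G] {a b : G} (ha : a * a = 1) (hb : b * b = 1)
    (n : ℤ) : (a * b) ^ n * a = a * (a * b) ^ (-n) := by
  have h : SemiconjBy a (a * b)⁻¹ (a * b) := by
    rw [SemiconjBy, mul_inv_rev, ← eq_inv_of_mul_eq_one_left hb, ← eq_inv_of_mul_eq_one_left ha,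
      ← mul_assoc]
  rw [← (h.zpow_right n).eq, inv_zpow']

/-- The homomorphism from the infinite dihedral group given by two involutions. -/
def dihedralHom {G : Type*} [Group G] (a b : G) (ha : a * a = 1) (hb : b * b = 1) :
    DihedralGroup 0 →* G :=
  MonoidHom.mk' (fun x ↦ match x with
    -- `ZMod 0` is `ℤ` by definition; the explicit `HPow` makes `i` an integer exponent.
    | .r i => @HPow.hPow G ℤ G _ (a * b) i
    | .sr i => a * @HPow.hPow G ℤ G _ (a * b) i) <| by
  have key := zpow_mul_of_involution ha hb
  have h1 (i j : ℤ) : a * (a * b) ^ (j - i) = (a * b) ^ i * (a * (a * b) ^ j) := by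
    rw [← mul_assoc, key, mul_assoc, ← zpow_add, neg_add_eq_sub]
  have h2 (i j : ℤ) : a * (a * b) ^ (i + j) = a * (a * b) ^ i * (a * b) ^ j := by
    rw [zpow_add, mul_assoc]
  have h3 (i j : ℤ) : (a * b) ^ (j - i) = a * (a * b) ^ i * (a * (a * b) ^ j) := by
    rw [← mul_assoc, mul_assoc a, key, ← mul_assoc, ha, one_mul, ← zpow_add, neg_add_eq_sub]
  rintro (i | i) (j | j)
  exacts [zpow_add (a * b) i j, h1 i j, h2 i j, h3 i j]

theorem dihedralHom_sr_zero {G : Type*} [Group G] (a b : G) (ha : a * a = 1) (hb : b * b = 1) :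
    dihedralHom a b ha hb (.sr 0) = a := by
  change a * (a * b) ^ (0 : ℤ) = a
  simp

theorem dihedralHom_sr_one {G : Type*} [Group G] (a b : G) (ha : a * a = 1) (hb : b * b = 1) :
    dihedralHom a b ha hb (.sr 1) = b := by
  change a * (a * b) ^ (1 : ℤ) = b
  rw [zpow_one, ← mul_assoc, ha, one_mul]

theorem dihedralGroup_zero_closure :
    Subgroup.closure ({.sr 0, .sr 1} : Set (DihedralGroup 0)) = ⊤ := by
  rw [eq_top_iff]
  have h0 : (.sr 0 : DihedralGroup 0) ∈ Subgroup.closure ({.sr 0, .sr 1} : Set _) :=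
    Subgroup.subset_closure (by simp)
  have h1 : (.sr 1 : DihedralGroup 0) ∈ Subgroup.closure ({.sr 0, .sr 1} : Set _) :=
    Subgroup.subset_closure (by simp)
  have hr : ∀ i : ℤ, (.r i : DihedralGroup 0) ∈ Subgroup.closure ({.sr 0, .sr 1} : Set _) := by
    intro i
    have : (.r i : DihedralGroup 0) = (.sr 0 * .sr 1) ^ i := by
      rw [DihedralGroup.sr_mul_sr, sub_zero, DihedralGroup.r_one_zpow]
      rfl
    rw [this]
    exact Subgroup.zpow_mem _ (Subgroup.mul_mem _ h0 h1) i
  rintro (i | i) -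
  · exact hr i
  · have : (.sr i : DihedralGroup 0) = .sr 0 * .r i := by
      rw [DihedralGroup.sr_mul_r, zero_add]
    rw [this]
    exact Subgroup.mul_mem _ h0 (hr i)

theorem dihedralGroup_zero_hom_ext {G : Type*} [Group G] {f g : DihedralGroup 0 →* G}
    (h0 : f (.sr 0) = g (.sr 0)) (h1 : f (.sr 1) = g (.sr 1)) : f = g := by
  refine MonoidHom.eq_of_eqOn_dense dihedralGroup_zero_closure ?_
  rintro x (rfl | rfl)
  exacts [h0, h1]

theorem pairwise_commute_involutionHom (r : ℕ) :
    Pairwise fun i j : Fin r ↦ ∀ x y : Multiplicative (ZMod 2),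
      Commute
        (involutionHom (PresentedGroup.of (Sum.inl i) : Cox (suspensionGraph r)) (cox_sq _ _) x)
        (involutionHom (PresentedGroup.of (Sum.inl j) : Cox (suspensionGraph r)) (cox_sq _ _) y) := by
  intro i j hij x y
  rcases multiplicative_zmod_two_cases x with rfl | rfl
  · simp
  rcases multiplicative_zmod_two_cases y with rfl | rfl
  · simp
  rw [involutionHom_ofAdd_one, involutionHom_ofAdd_one]
  exact cox_commute _ (suspensionGraph_adj_inl_inl hij)

/-- The map `(ℤ/2)^r → cox(𝒜_r)` onto the subgroup generated by the complete graph. -/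
noncomputable def elemAbToCox (r : ℕ) : ElemAb r →* Cox (suspensionGraph r) :=
  MonoidHom.noncommPiCoprod _ (pairwise_commute_involutionHom r)

theorem elemAbToCox_mulSingle {r : ℕ} (i : Fin r) :
    elemAbToCox r (Pi.mulSingle i (Multiplicative.ofAdd 1)) = PresentedGroup.of (Sum.inl i) := by
  rw [elemAbToCox, MonoidHom.noncommPiCoprod_mulSingle, involutionHom_ofAdd_one]

/-- The map `D_∞ → cox(𝒜_r)` onto the subgroup generated by the two suspension vertices. -/
noncomputable def dihedralToCox (r : ℕ) : DihedralGroup 0 →* Cox (suspensionGraph r) :=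
  dihedralHom (PresentedGroup.of (Sum.inr 0)) (PresentedGroup.of (Sum.inr 1))
    (cox_sq _ _) (cox_sq _ _)

theorem closure_mulSingle (r : ℕ) :
    Subgroup.closure (Set.range fun i : Fin r ↦
      (Pi.mulSingle i (Multiplicative.ofAdd 1) : ElemAb r)) = ⊤ := by
  rw [eq_top_iff]
  rintro x -
  rw [← Finset.univ_prod_mulSingle x]
  refine Subgroup.prod_mem _ fun i _ ↦ ?_
  rcases multiplicative_zmod_two_cases (x i) with h | h
  · rw [h, Pi.mulSingle_one]
    exact Subgroup.one_mem _
  · rw [h]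
    exact Subgroup.subset_closure ⟨i, rfl⟩

theorem commute_elemAbToCox_dihedralToCox {r : ℕ} (x : ElemAb r) (y : DihedralGroup 0) :
    Commute (elemAbToCox r x) (dihedralToCox r y) := by
  have hy : y ∈ Subgroup.closure ({.sr 0, .sr 1} : Set (DihedralGroup 0)) := by
    rw [dihedralGroup_zero_closure]; trivial
  have hx : x ∈ Subgroup.closure (Set.range fun i : Fin r ↦
      (Pi.mulSingle i (Multiplicative.ofAdd 1) : ElemAb r)) := by
    rw [closure_mulSingle]; trivial
  induction hx using Subgroup.closure_induction with
  | one => simp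
  | mul _ _ _ _ h h' => rw [map_mul]; exact h.mul_left h'
  | inv _ _ h => rw [map_inv]; exact h.inv_left
  | mem _ hx =>
    obtain ⟨i, rfl⟩ := hx
    induction hy using Subgroup.closure_induction with
    | one => simp
    | mul _ _ _ _ h h' => rw [map_mul]; exact h.mul_right h'
    | inv _ _ h => rw [map_inv]; exact h.inv_right
    | mem _ hy =>
      rw [elemAbToCox_mulSingle]
      rcases hy with rfl | rfl
      · rw [dihedralToCox, dihedralHom_sr_zero]
        exact cox_commute _ (suspensionGraph_adj_inl_inr _ _)
      · rw [dihedralToCox, dihedralHom_sr_one]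
        exact cox_commute _ (suspensionGraph_adj_inl_inr _ _)

/-- The images of the generators of `cox(𝒜_r)` in `(ℤ/2)^r × D_∞`. -/
def coxGenerator (r : ℕ) : Fin r ⊕ Fin 2 → ElemAb r × DihedralGroup 0
  | .inl i => (Pi.mulSingle i (Multiplicative.ofAdd 1), 1)
  | .inr i => (1, .sr (i : ℕ))

theorem coxGenerator_rels (r : ℕ) :
    ∀ x ∈ racgRels (suspensionGraph r), FreeGroup.lift (coxGenerator r) x = 1 := by
  rintro x (⟨v, rfl⟩ | ⟨v, w, h, rfl⟩)
  · rw [map_pow, FreeGroup.lift_apply_of]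
    rcases v with i | i
    · have : (Multiplicative.ofAdd (1 : ZMod 2)) ^ 2 = 1 := by decide
      simp [coxGenerator, ← Pi.mulSingle_pow, this]
    · simp [coxGenerator, pow_two]
  · simp only [map_mul, map_inv, FreeGroup.lift_apply_of, mul_inv_eq_iff_eq_mul]
    rcases v with i | i <;> rcases w with j | j
    · simp [coxGenerator, mul_comm]
    · simp [coxGenerator]
    · simp [coxGenerator]
    · simp [suspensionGraph] at h

/-- `cox(𝒜_r)` is the direct product of `(ℤ/2)^r` and the infinite dihedral group. -/
noncomputable def coxEquiv (r : ℕ) :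
    Cox (suspensionGraph r) ≃* ElemAb r × DihedralGroup 0 :=
  MonoidHom.toMulEquiv (PresentedGroup.toGroup (coxGenerator_rels r))
    (MonoidHom.noncommCoprod (elemAbToCox r) (dihedralToCox r) commute_elemAbToCox_dihedralToCox)
    (by
      refine PresentedGroup.ext fun v ↦ ?_
      rw [MonoidHom.comp_apply, PresentedGroup.toGroup.of, MonoidHom.noncommCoprod_apply]
      rcases v with i | i
      · simp [coxGenerator, elemAbToCox_mulSingle]
      · fin_cases i
        · simp [coxGenerator, dihedralToCox, dihedralHom_sr_zero]
        · simp [coxGenerator, dihedralToCox, dihedralHom_sr_one])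
    (by
      have h1 : (PresentedGroup.toGroup (coxGenerator_rels r)).comp (elemAbToCox r) =
          MonoidHom.inl _ _ := by
        refine MonoidHom.eq_of_eqOn_dense (closure_mulSingle r) ?_
        rintro _ ⟨i, rfl⟩
        simp [elemAbToCox_mulSingle, coxGenerator]
      have h2 : (PresentedGroup.toGroup (coxGenerator_rels r)).comp (dihedralToCox r) =
          MonoidHom.inr _ _ := by
        apply dihedralGroup_zero_hom_ext
        · simp [dihedralToCox, dihedralHom_sr_zero, coxGenerator]
        · simp [dihedralToCox, dihedralHom_sr_one, coxGenerator]
      ext1 x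
      have e1 := DFunLike.congr_fun h1 x.1
      have e2 := DFunLike.congr_fun h2 x.2
      simp only [MonoidHom.comp_apply, MonoidHom.inl_apply, MonoidHom.inr_apply] at e1 e2
      rw [MonoidHom.comp_apply, MonoidHom.noncommCoprod_apply, map_mul, e1, e2]
      simp)

end CoxeterGroup
-- Finite-index subgroups of `D_∞` and their homomorphisms
section InfiniteDihedral

/-- The rotation `r k` of the infinite dihedral group, indexed by an integer. -/
def intRotation (k : ℤ) : DihedralGroup 0 := .r k

/-- The reflection `sr k` of the infinite dihedral group, indexed by an integer. -/
def intReflection (k : ℤ) : DihedralGroup 0 := .sr k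

theorem intRotation_or_reflection (x : DihedralGroup 0) :
    (∃ k, x = intRotation k) ∨ ∃ k, x = intReflection k := by
  rcases x with k | k
  exacts [.inl ⟨k, rfl⟩, .inr ⟨k, rfl⟩]

theorem intRotation_zero : intRotation 0 = 1 := rfl

theorem intRotation_inj {k l : ℤ} : intRotation k = intRotation l ↔ k = l :=
  ⟨fun h ↦ DihedralGroup.r.inj h, congrArg _⟩

theorem intReflection_inj {k l : ℤ} : intReflection k = intReflection l ↔ k = l :=
  ⟨fun h ↦ DihedralGroup.sr.inj h, congrArg _⟩

theorem intReflection_ne_rotation (k l : ℤ) : intReflection k ≠ intRotation l := nofun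

theorem intRotation_mul_reflection (i j : ℤ) :
    intRotation i * intReflection j = intReflection (j - i) := rfl

theorem intReflection_mul_rotation (i j : ℤ) :
    intReflection i * intRotation j = intReflection (i + j) := rfl

theorem intReflection_mul_reflection (i j : ℤ) :
    intReflection i * intReflection j = intRotation (j - i) := rfl

theorem intRotation_zpow (i k : ℤ) : intRotation i ^ k = intRotation (i * k) :=
  (DihedralGroup.r_zpow (n := 0) i k).trans rfl

theorem mem_zpowers_rotation {d k : ℤ} :
    intRotation k ∈ Subgroup.zpowers (intRotation d) ↔ d ∣ k := by
  simp_rw [Subgroup.mem_zpowers_iff, intRotation_zpow, intRotation_inj]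
  exact ⟨fun ⟨c, h⟩ ↦ ⟨c, h.symm⟩, fun ⟨c, h⟩ ↦ ⟨c, h.symm⟩⟩

theorem intReflection_notMem_zpowers {d k : ℤ} :
    intReflection k ∉ Subgroup.zpowers (intRotation d) := by
  simp_rw [Subgroup.mem_zpowers_iff, intRotation_zpow]
  rintro ⟨l, h⟩
  exact intReflection_ne_rotation _ _ h.symm

theorem zpowersHom_rotation_injective {d : ℤ} (hd : d ≠ 0) :
    Function.Injective (zpowersHom (DihedralGroup 0) (intRotation d)) := by
  intro x y h
  rw [zpowersHom_apply, zpowersHom_apply, intRotation_zpow, intRotation_zpow, intRotation_inj] at h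
  exact mul_left_cancel₀ (M₀ := ℤ) hd h

theorem index_zpowers_rotation_one : (Subgroup.zpowers (intRotation 1)).index = 2 := by
  rw [Subgroup.index_eq_two_iff]
  refine ⟨intReflection 0, fun x ↦ ?_⟩
  obtain ⟨i, rfl⟩ | ⟨i, rfl⟩ := intRotation_or_reflection x
  · rw [intRotation_mul_reflection]
    exact Or.inr ⟨mem_zpowers_rotation.2 (one_dvd _), intReflection_notMem_zpowers⟩
  · rw [intReflection_mul_reflection]
    exact Or.inl ⟨mem_zpowers_rotation.2 (one_dvd _), intReflection_notMem_zpowers⟩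

/-- This is the image of `dℤ` under the embedding `k ↦ r k`, whose range has index two. -/
theorem index_zpowers_rotation (d : ℕ) : (Subgroup.zpowers (intRotation d)).index = d * 2 := by
  have h1 : Subgroup.zpowers (intRotation d) =
      (Subgroup.zpowers (Multiplicative.ofAdd (d : ℤ))).map
        (zpowersHom (DihedralGroup 0) (intRotation 1)) := by
    rw [MonoidHom.map_zpowers, zpowersHom_apply, intRotation_zpow, one_mul]
    rfl
  have h2 : (Subgroup.zpowers (Multiplicative.ofAdd (d : ℤ))).index = d :=
    Int.index_zmultiples d
  rw [h1, Subgroup.index_map_of_injective _ (zpowersHom_rotation_injective one_ne_zero), h2,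
    ← index_zpowers_rotation_one]
  rfl

theorem intReflection_mul_self (i : ℤ) : intReflection i * intReflection i = 1 :=
  DihedralGroup.sr_mul_self (n := 0) i

/-- The endomorphism of `D_∞` with `r k ↦ r (d k)` and `sr k ↦ sr (i + d k)`. -/
def dihedralDilation (d i : ℤ) : DihedralGroup 0 →* DihedralGroup 0 :=
  dihedralHom (intReflection i) (intReflection (i + d))
    (intReflection_mul_self _) (intReflection_mul_self _)

theorem dihedralDilation_rotation (d i k : ℤ) :
    dihedralDilation d i (intRotation k) = intRotation (d * k) := by
  change (intReflection i * intReflection (i + d)) ^ k = _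
  rw [intReflection_mul_reflection, add_sub_cancel_left, intRotation_zpow]

theorem dihedralDilation_reflection (d i k : ℤ) :
    dihedralDilation d i (intReflection k) = intReflection (i + d * k) := by
  change intReflection i * (intReflection i * intReflection (i + d)) ^ k = _
  rw [intReflection_mul_reflection, add_sub_cancel_left, intRotation_zpow,
    intReflection_mul_rotation]

theorem dihedralDilation_injective {d : ℤ} (hd : d ≠ 0) (i : ℤ) :
    Function.Injective (dihedralDilation d i) := by
  rw [injective_iff_map_eq_one]
  intro x h
  obtain ⟨k, rfl⟩ | ⟨k, rfl⟩ := intRotation_or_reflection x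
  · rw [dihedralDilation_rotation, ← intRotation_zero, intRotation_inj] at h
    rw [(mul_eq_zero_iff_left hd).1 h, intRotation_zero]
  · rw [dihedralDilation_reflection, ← intRotation_zero] at h
    exact absurd h (intReflection_ne_rotation _ _)

theorem rotation_mem_range_dihedralDilation {d i k : ℤ} :
    intRotation k ∈ (dihedralDilation d i).range ↔ d ∣ k := by
  constructor
  · rintro ⟨x, h⟩
    obtain ⟨l, rfl⟩ | ⟨l, rfl⟩ := intRotation_or_reflection x
    · rw [dihedralDilation_rotation, intRotation_inj] at h
      exact ⟨l, h.symm⟩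
    · rw [dihedralDilation_reflection] at h
      exact absurd h (intReflection_ne_rotation _ _)
  · rintro ⟨l, rfl⟩
    exact ⟨intRotation l, dihedralDilation_rotation d i l⟩

theorem intReflection_mem_range_dihedralDilation {d i k : ℤ} :
    intReflection k ∈ (dihedralDilation d i).range ↔ d ∣ k - i := by
  constructor
  · rintro ⟨x, h⟩
    obtain ⟨l, rfl⟩ | ⟨l, rfl⟩ := intRotation_or_reflection x
    · rw [dihedralDilation_rotation] at h
      exact absurd h.symm (intReflection_ne_rotation _ _)
    · rw [dihedralDilation_reflection, intReflection_inj] at h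
      exact ⟨l, sub_eq_of_eq_add' h.symm⟩
  · rintro ⟨l, h⟩
    refine ⟨intReflection l, ?_⟩
    rw [dihedralDilation_reflection, ← h, add_sub_cancel]

/-- The dilation maps `⟨r 1⟩`, of index 2, onto `⟨r d⟩`, of index `2d`; injectivity then gives `2d =
2 · index`. -/
theorem index_range_dihedralDilation {d : ℕ} (hd : d ≠ 0) (i : ℤ) :
    (dihedralDilation d i).range.index = d := by
  have h := Subgroup.index_map_of_injective (Subgroup.zpowers (intRotation 1))
    (dihedralDilation_injective (Nat.cast_ne_zero.2 hd) i)
  rw [MonoidHom.map_zpowers, dihedralDilation_rotation, mul_one, index_zpowers_rotation,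
    index_zpowers_rotation_one] at h
  omega

theorem exists_dvd_iff_rotation_mem {K : Subgroup (DihedralGroup 0)} (hK : K.index ≠ 0) :
    ∃ d : ℕ, d ≠ 0 ∧ ∀ k : ℤ, intRotation k ∈ K ↔ (d : ℤ) ∣ k := by
  let L : AddSubgroup ℤ :=
    { carrier := {k | intRotation k ∈ K}
      zero_mem' := K.one_mem
      add_mem' := fun h h' ↦ K.mul_mem h h'
      neg_mem' := fun h ↦ K.inv_mem h }
  obtain ⟨a, ha⟩ := Int.subgroup_cyclic L
  have hmem (k : ℤ) : intRotation k ∈ K ↔ (a.natAbs : ℤ) ∣ k := by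
    rw [Int.natAbs_dvd, ← Int.mem_zmultiples_iff, AddSubgroup.zmultiples_eq_closure, ← ha]
    rfl
  refine ⟨a.natAbs, fun h0 ↦ ?_, hmem⟩
  -- Finite index forces a positive power of `r 1` into `K`, which excludes `d = 0`.
  obtain ⟨n, hn, -, h⟩ := Subgroup.exists_pow_mem_of_index_ne_zero hK (intRotation 1)
  rw [← zpow_natCast, intRotation_zpow, hmem, h0, one_mul, Nat.cast_zero, zero_dvd_iff] at h
  omega

/-- The subgroups of index `m` in the infinite dihedral group: `m` infinite dihedral ones, and
one infinite cyclic one if `m` is even. -/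
def dihedralSubgroup (m : ℕ) [NeZero m] :
    Fin m ⊕ PLift (2 ∣ m) → {K : Subgroup (DihedralGroup 0) // K.index = m}
  | .inl i => ⟨(dihedralDilation m (i : ℕ)).range, index_range_dihedralDilation (NeZero.ne m) _⟩
  | .inr h => ⟨Subgroup.zpowers (intRotation (m / 2 : ℕ)), by
      rw [index_zpowers_rotation, Nat.div_mul_cancel h.down]⟩

/-- The rotations in `K` are the multiples of some `d`. If `K` contains a reflection `sr i`, its
reflections are the `sr k` with `k ≡ i` mod `d`, and the index is `d`; otherwise `K = ⟨r d⟩` has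
index `2d`. -/
theorem dihedralSubgroup_bijective (m : ℕ) [NeZero m] :
    Function.Bijective (dihedralSubgroup m) := by
  have hne (i : Fin m) (h : PLift (2 ∣ m)) :
      dihedralSubgroup m (.inl i) ≠ dihedralSubgroup m (.inr h) := by
    intro he
    have h1 : intReflection (i : ℕ) ∈ (dihedralSubgroup m (.inl i)).1 :=
      intReflection_mem_range_dihedralDilation.2 (by simp)
    rw [he] at h1
    exact intReflection_notMem_zpowers h1
  constructor
  · rintro (i | h) (j | h') he
    · have h1 : intReflection (i : ℕ) ∈ (dihedralSubgroup m (.inl i)).1 :=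
        intReflection_mem_range_dihedralDilation.2 (by simp)
      rw [he] at h1
      have h2 := intReflection_mem_range_dihedralDilation.1 h1
      have h3 := (Int.emod_emod_of_dvd _ dvd_rfl).symm.trans (Int.emod_emod_of_dvd _ dvd_rfl)
        |>.trans (Int.emod_eq_emod_iff_emod_sub_eq_zero.2 (Int.emod_eq_zero_of_dvd h2))
      rw [Int.emod_eq_of_lt (by positivity) (by exact_mod_cast i.2),
        Int.emod_eq_of_lt (by positivity) (by exact_mod_cast j.2)] at h3
      exact congrArg _ (Fin.ext (by exact_mod_cast h3))
    · exact absurd he (hne i h')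
    · exact absurd he.symm (hne j h)
    · exact congrArg _ (Subsingleton.elim h h')
  · rintro ⟨K, hK⟩
    obtain ⟨d, hd, hr⟩ := exists_dvd_iff_rotation_mem (K := K) (by rw [hK]; exact NeZero.ne m)
    by_cases hs : ∃ i : ℤ, intReflection i ∈ K
    · obtain ⟨i, hi⟩ := hs
      have hsr (k : ℤ) : intReflection k ∈ K ↔ (d : ℤ) ∣ k - i := by
        rw [← hr, ← K.mul_mem_cancel_left (y := intRotation (k - i)) hi, intReflection_mul_rotation,
          add_sub_cancel]
      have hKd (i' : ℤ) (hi' : (d : ℤ) ∣ i - i') : (dihedralDilation d i').range = K := by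
        ext x
        obtain ⟨k, rfl⟩ | ⟨k, rfl⟩ := intRotation_or_reflection x
        · exact rotation_mem_range_dihedralDilation.trans (hr k).symm
        · refine intReflection_mem_range_dihedralDilation.trans (Iff.trans ?_ (hsr k).symm)
          rw [← sub_add_sub_cancel k i i', dvd_add_left hi']
      obtain rfl : d = m := by
        rw [← hK, ← hKd i (by simp), index_range_dihedralDilation hd]
      have hd' : (d : ℤ) ≠ 0 := Nat.cast_ne_zero.2 hd
      have hnonneg := Int.emod_nonneg i hd'
      -- Only the residue of `i` mod `d` matters, so its representative in `[0, d)` is taken.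
      refine ⟨.inl ⟨(i % d).toNat, ?_⟩, Subtype.ext ?_⟩
      · have := Int.emod_lt_of_pos i (b := d) (by positivity)
        omega
      · refine hKd _ ?_
        simp only [Int.toNat_of_nonneg hnonneg]
        exact Int.dvd_self_sub_emod
    · have hKd : Subgroup.zpowers (intRotation d) = K := by
        ext x
        obtain ⟨k, rfl⟩ | ⟨k, rfl⟩ := intRotation_or_reflection x
        · exact mem_zpowers_rotation.trans (hr k).symm
        · exact iff_of_false intReflection_notMem_zpowers fun h ↦ hs ⟨k, h⟩
      have hm : m = d * 2 := by rw [← hK, ← hKd, index_zpowers_rotation]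
      refine ⟨.inr ⟨hm ▸ Nat.dvd_mul_left 2 d⟩, Subtype.ext (Eq.trans ?_ hKd)⟩
      have hmd : m / 2 = d := by omega
      change Subgroup.zpowers (intRotation (m / 2 : ℕ)) = _
      rw [hmd]

/-- Homomorphisms from `D_∞` to a group of exponent two. -/
noncomputable def dihedralHomEquiv {Q : Type*} [Group Q] (hQ : ∀ x : Q, x * x = 1) :
    (DihedralGroup 0 →* Q) ≃ Q × Q where
  toFun f := (f (.sr 0), f (.sr 1))
  invFun x := dihedralHom x.1 x.2 (hQ _) (hQ _)
  left_inv _ := dihedralGroup_zero_hom_ext (dihedralHom_sr_zero ..) (dihedralHom_sr_one ..)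
  right_inv _ := Prod.ext (dihedralHom_sr_zero ..) (dihedralHom_sr_one ..)

/-- Homomorphisms from subgroups of index `m` of `D_∞` to a group of exponent two. -/
noncomputable def sigmaDihedralSubgroupHomEquiv {Q : Type*} [Group Q] (hQ : ∀ x : Q, x * x = 1)
    (m : ℕ) [NeZero m] :
    (Σ K : {K : Subgroup (DihedralGroup 0) // K.index = m}, K.1 →* Q) ≃
      (Fin m × Q × Q) ⊕ (PLift (2 ∣ m) × Q) :=
  (((Equiv.ofBijective _ (dihedralSubgroup_bijective m)).sigmaCongrLeft
    (β := fun K ↦ K.1 →* Q)).symm.trans (Equiv.sumSigmaDistrib _)).trans <|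
  Equiv.sumCongr
    -- Here `K` is a copy of `D_∞`, giving two free elements of `Q`; in the other summand it is a
    -- copy of `ℤ`, giving one.
    (Equiv.sigmaEquivProdOfEquiv fun i ↦
      (MonoidHom.ofInjective (dihedralDilation_injective (Nat.cast_ne_zero.2 (NeZero.ne m))
        (i : ℕ))).symm.monoidHomCongrLeftEquiv.trans (dihedralHomEquiv hQ))
    (Equiv.sigmaEquivProdOfEquiv fun h ↦
      (MonoidHom.ofInjective (zpowersHom_rotation_injective (d := (m / 2 : ℕ)) (by
        have := NeZero.ne m
        have := h.down
        omega))).symm.monoidHomCongrLeftEquiv.trans (zpowersHom Q).symm)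

theorem card_sigma_dihedralSubgroup_hom {Q : Type*} [Group Q] [Finite Q]
    (hQ : ∀ x : Q, x * x = 1) (m : ℕ) [NeZero m] :
    Nat.card (Σ K : {K : Subgroup (DihedralGroup 0) // K.index = m}, K.1 →* Q) =
      m * Nat.card Q ^ 2 + if 2 ∣ m then Nat.card Q else 0 := by
  rw [Nat.card_congr (sigmaDihedralSubgroupHomEquiv hQ m), Nat.card_sum, Nat.card_prod,
    Nat.card_prod, Nat.card_prod, Nat.card_fin, pow_two]
  split_ifs with h <;> simp [h]

end InfiniteDihedral
-- Counting subgroups of `(ℤ/2)^r` as subspaces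
section SubspaceCount

open Module

/-- A linearly independent family is a basis of its span. -/
noncomputable def linearIndependentEquivSigma (K V : Type*) [Field K] [AddCommGroup V] [Module K V]
    [FiniteDimensional K V] (j : ℕ) :
    {s : Fin j → V // LinearIndependent K s} ≃
      Σ U : {U : Submodule K V // finrank K U = j}, {t : Fin j → U.1 // LinearIndependent K t} where
  toFun s := ⟨⟨Submodule.span K (Set.range s.1), by
      rw [finrank_span_eq_card s.2, Fintype.card_fin]⟩,
    ⟨fun i ↦ ⟨s.1 i, Submodule.subset_span ⟨i, rfl⟩⟩,
      LinearIndependent.of_comp (Submodule.subtype _) s.2⟩⟩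
  invFun x := ⟨fun i ↦ (x.2.1 i : V), x.2.2.map' (Submodule.subtype _) (Submodule.ker_subtype _)⟩
  left_inv _ := rfl
  right_inv := by
    rintro ⟨⟨U, hU⟩, ⟨t, ht⟩⟩
    have hspan : Submodule.span K (Set.range fun i ↦ (t i : V)) = U := by
      refine Submodule.eq_of_le_of_finrank_eq ?_ ?_
      · rw [Submodule.span_le]
        rintro _ ⟨i, rfl⟩
        exact (t i).2
      · exact (finrank_span_eq_card
          (ht.map' (Submodule.subtype _) (Submodule.ker_subtype _))).trans
          ((Fintype.card_fin j).trans hU.symm)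
    -- The span is generalised to a variable `W`, so that it can be substituted in this equality of
    -- dependent pairs.
    have aux (W : Submodule K V) (hW : W = U) (h1 : finrank K W = j) (t' : Fin j → W)
        (ht' : LinearIndependent K t') (h : ∀ i, (t' i : V) = t i) :
        (⟨⟨W, h1⟩, ⟨t', ht'⟩⟩ : Σ U : {U : Submodule K V // finrank K U = j},
          {t : Fin j → U.1 // LinearIndependent K t}) = ⟨⟨U, hU⟩, ⟨t, ht⟩⟩ := by
      subst hW
      obtain rfl : t' = t := funext fun i ↦ Subtype.ext (h i)
      rfl
    exact aux _ hspan _ _ _ fun _ ↦ rfl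

/-- The number of `j`-dimensional subspaces of a finite vector space. -/
theorem card_subspaces_mul (K V : Type*) [Field K] [Fintype K] [AddCommGroup V] [Module K V]
    [Finite V] {j : ℕ} (hj : j ≤ finrank K V) :
    Nat.card {U : Submodule K V // finrank K U = j} *
        ∏ i : Fin j, (Fintype.card K ^ j - Fintype.card K ^ (i : ℕ)) =
      ∏ i : Fin j, (Fintype.card K ^ finrank K V - Fintype.card K ^ (i : ℕ)) := by
  classical
  have : Fintype {U : Submodule K V // finrank K U = j} := Fintype.ofFinite _
  -- Double count of independent `j`-tuples: in all of `V`, and grouped by their span.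
  rw [← card_linearIndependent hj, Nat.card_congr (linearIndependentEquivSigma K V j),
    Nat.card_sigma]
  have (U : {U : Submodule K V // finrank K U = j}) :
      Nat.card {t : Fin j → U.1 // LinearIndependent K t} =
        ∏ i : Fin j, (Fintype.card K ^ j - Fintype.card K ^ (i : ℕ)) := by
    rw [card_linearIndependent U.2.ge, U.2]
  simp_rw [this]
  rw [Finset.sum_const, Finset.card_univ, Nat.card_eq_fintype_card, smul_eq_mul]

/-- Annihilators exchange subspaces of codimension `j` and subspaces of dimension `j`. -/
theorem card_subspaces_codim (K V : Type*) [Field K] [AddCommGroup V] [Module K V]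
    [FiniteDimensional K V] (j : ℕ) :
    Nat.card {U : Submodule K V // finrank K U + j = finrank K V} =
      Nat.card {U : Submodule K (Dual K V) // finrank K U = j} := by
  refine Nat.card_congr
    (((Subspace.orderIsoFiniteDimensional (K := K) (V := V)).toEquiv.trans
      OrderDual.ofDual).subtypeEquiv fun U ↦ ?_)
  have := Subspace.finrank_add_finrank_dualAnnihilator_eq U
  change _ ↔ finrank K (Submodule.dualAnnihilator U) = j
  omega

/-- Subgroups of `(ℤ/2)^r` are the subspaces of `𝔽₂^r`. -/
noncomputable def elemAbSubgroupEquiv (r : ℕ) :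
    Subgroup (ElemAb r) ≃ Submodule (ZMod 2) (Fin r → ZMod 2) where
  toFun H := AddSubgroup.toZModSubmodule 2
    { carrier := {x | (fun i ↦ Multiplicative.ofAdd (x i) : ElemAb r) ∈ H}
      zero_mem' := H.one_mem
      add_mem' := fun h h' ↦ H.mul_mem h h'
      neg_mem' := fun h ↦ H.inv_mem h }
  invFun U :=
    { carrier := {x | (fun i ↦ (x i).toAdd : Fin r → ZMod 2) ∈ U}
      one_mem' := U.zero_mem
      mul_mem' := fun h h' ↦ U.add_mem h h'
      inv_mem' := fun h ↦ U.neg_mem h }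
  left_inv _ := rfl
  right_inv _ := rfl

theorem card_elemAbSubgroupEquiv {r : ℕ} (H : Subgroup (ElemAb r)) :
    Nat.card H = 2 ^ finrank (ZMod 2) (elemAbSubgroupEquiv r H) := by
  have h := Module.natCard_eq_pow_finrank (K := ZMod 2) (V := elemAbSubgroupEquiv r H)
  rw [Nat.card_zmod] at h
  rw [← h]
  exact Nat.card_congr
    { toFun := fun x ↦ ⟨fun i ↦ (x.1 i).toAdd, x.2⟩
      invFun := fun x ↦ ⟨fun i ↦ Multiplicative.ofAdd (x.1 i), x.2⟩
      left_inv := fun _ ↦ rfl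
      right_inv := fun _ ↦ rfl }

theorem index_eq_two_pow_iff {r j : ℕ} (H : Subgroup (ElemAb r)) :
    H.index = 2 ^ j ↔ finrank (ZMod 2) (elemAbSubgroupEquiv r H) + j = r := by
  have h := H.card_mul_index
  have hc : Nat.card (ElemAb r) = 2 ^ r := by
    simp [Nat.card_eq_fintype_card]
  rw [card_elemAbSubgroupEquiv, hc] at h
  constructor
  · intro hj
    rw [hj, ← pow_add] at h
    exact Nat.pow_right_injective le_rfl h
  · intro hj
    conv_rhs at h => rw [← hj, pow_add]
    exact Nat.eq_of_mul_eq_mul_left (by positivity) h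

theorem exists_index_eq_two_pow {r : ℕ} (H : Subgroup (ElemAb r)) :
    ∃ j ≤ r, H.index = 2 ^ j := by
  have h := Submodule.finrank_le (elemAbSubgroupEquiv r H)
  rw [Module.finrank_fin_fun] at h
  exact ⟨r - _, Nat.sub_le _ _, (index_eq_two_pow_iff H).2 (Nat.add_sub_cancel' h)⟩

theorem subgroupCount_elemAb {r j : ℕ} (hj : j ≤ r) :
    (subgroupCount (ElemAb r) (2 ^ j) : ℚ) =
      (∏ l ∈ Finset.range j, ((2 : ℚ) ^ r - 2 ^ l)) /
        (∏ l ∈ Finset.range j, ((2 : ℚ) ^ j - 2 ^ l)) := by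
  have hV : finrank (ZMod 2) (Fin r → ZMod 2) = r := Module.finrank_fin_fun _
  have hdual : finrank (ZMod 2) (Dual (ZMod 2) (Fin r → ZMod 2)) = r := by
    rw [Subspace.dual_finrank_eq, hV]
  have hcount : subgroupCount (ElemAb r) (2 ^ j) =
      Nat.card {U : Submodule (ZMod 2) (Dual (ZMod 2) (Fin r → ZMod 2)) //
        finrank (ZMod 2) U = j} := by
    rw [← card_subspaces_codim]
    exact Nat.card_congr ((elemAbSubgroupEquiv r).subtypeEquiv fun H ↦ by
      rw [index_eq_two_pow_iff, hV])
  have : Finite (Dual (ZMod 2) (Fin r → ZMod 2)) := Module.finite_of_finite (ZMod 2)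
  have key := card_subspaces_mul (ZMod 2) (Dual (ZMod 2) (Fin r → ZMod 2)) (j := j)
    (by rw [hdual]; exact hj)
  rw [← hcount, hdual, ZMod.card] at key
  have cast_prod {m : ℕ} (hm : j ≤ m) : ((∏ i : Fin j, (2 ^ m - 2 ^ (i : ℕ)) : ℕ) : ℚ) =
      ∏ l ∈ Finset.range j, ((2 : ℚ) ^ m - 2 ^ l) := by
    rw [Finset.prod_range, Nat.cast_prod]
    refine Finset.prod_congr rfl fun i _ ↦ ?_
    -- The natural subtraction is not truncated, as `i < j ≤ m`.
    rw [Nat.cast_sub (Nat.pow_le_pow_right two_pos (i.2.le.trans hm))]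
    norm_cast
  have hne : (∏ l ∈ Finset.range j, ((2 : ℚ) ^ j - 2 ^ l)) ≠ 0 := by
    refine Finset.prod_ne_zero_iff.2 fun l hl ↦ ?_
    rw [sub_ne_zero]
    exact (pow_lt_pow_right₀ one_lt_two (Finset.mem_range.1 hl)).ne'
  rw [eq_div_iff hne, ← cast_prod hj, ← cast_prod le_rfl, ← Nat.cast_mul, key]

end SubspaceCount
-- Summing over the subgroups of `(ℤ/2)^r`
section MainCount

/-- The contribution of one `B`, with `Q = A/B`: if `n = |Q| m`, then `m |Q|^2 = n |Q|`. Finiteness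
is recorded because the cardinality of a sigma type is a sum only over finite fibres. -/
theorem finite_and_card_sigma_index_mul_hom {Q : Type*} [Group Q] [Finite Q]
    (hQ : ∀ x : Q, x * x = 1) {n : ℕ} (hn : n ≠ 0) :
    Finite (Σ K : {K : Subgroup (DihedralGroup 0) // Nat.card Q * K.index = n}, K.1 →* Q) ∧
    Nat.card (Σ K : {K : Subgroup (DihedralGroup 0) // Nat.card Q * K.index = n}, K.1 →* Q) =
      (if Nat.card Q ∣ n then n * Nat.card Q else 0) +
        if Nat.card Q * 2 ∣ n then Nat.card Q else 0 := by
  have hq : 0 < Nat.card Q := Nat.card_pos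
  by_cases h : Nat.card Q ∣ n
  · obtain ⟨m, rfl⟩ := h
    have : NeZero m := ⟨right_ne_zero_of_mul hn⟩
    have e : (Σ K : {K : Subgroup (DihedralGroup 0) // Nat.card Q * K.index = Nat.card Q * m},
        K.1 →* Q) ≃ Σ K : {K : Subgroup (DihedralGroup 0) // K.index = m}, K.1 →* Q :=
      (Equiv.subtypeEquivRight fun K ↦ Nat.mul_right_inj hq.ne').sigmaCongr fun _ ↦ Equiv.refl _
    refine ⟨Finite.of_equiv _ (e.trans (sigmaDihedralSubgroupHomEquiv hQ m)).symm, ?_⟩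
    rw [Nat.card_congr e, card_sigma_dihedralSubgroup_hom hQ, if_pos (dvd_mul_right _ _)]
    simp_rw [Nat.mul_dvd_mul_iff_left hq]
    ring
  · have : IsEmpty {K : Subgroup (DihedralGroup 0) // Nat.card Q * K.index = n} :=
      ⟨fun K ↦ h ⟨_, K.2.symm⟩⟩
    refine ⟨inferInstance, ?_⟩
    rw [if_neg h, if_neg fun h' ↦ h (dvd_of_mul_right_dvd h'), Nat.card_of_isEmpty]

theorem elemAb_quotient_mul_self {r : ℕ} (B : Subgroup (ElemAb r)) (x : ElemAb r ⧸ B) :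
    x * x = 1 := by
  obtain ⟨a, rfl⟩ := QuotientGroup.mk_surjective x
  have h2 : ∀ y : Multiplicative (ZMod 2), y * y = 1 := by decide
  have : a * a = 1 := funext fun i ↦ h2 (a i)
  rw [← QuotientGroup.mk_mul, this, QuotientGroup.mk_one]

theorem sum_subgroups_elemAb (r : ℕ) [Fintype (Subgroup (ElemAb r))] (f : ℕ → ℕ) :
    ∑ B : Subgroup (ElemAb r), f B.index =
      ∑ j ∈ Finset.range (r + 1), subgroupCount (ElemAb r) (2 ^ j) * f (2 ^ j) := by
  classical
  have hmaps : ∀ B ∈ (Finset.univ : Finset (Subgroup (ElemAb r))),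
      B.index ∈ (Finset.range (r + 1)).image (2 ^ ·) := by
    intro B _
    obtain ⟨j, hj, h⟩ := exists_index_eq_two_pow B
    exact Finset.mem_image.2 ⟨j, Finset.mem_range.2 (by omega), h.symm⟩
  rw [← Finset.sum_fiberwise_of_maps_to hmaps,
    Finset.sum_image fun i _ j _ h ↦ Nat.pow_right_injective le_rfl h]
  refine Finset.sum_congr rfl fun j _ ↦ ?_
  rw [Finset.sum_congr rfl fun B hB ↦ congrArg f (Finset.mem_filter.1 hB).2, Finset.sum_const,
    smul_eq_mul, subgroupCount, Nat.card_eq_fintype_card, Fintype.card_subtype]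

theorem subgroupCount_elemAb_prod_dihedral (r : ℕ) {n : ℕ} (hn : n ≠ 0) :
    subgroupCount (ElemAb r × DihedralGroup 0) n =
      ∑ j ∈ Finset.range (r + 1), subgroupCount (ElemAb r) (2 ^ j) *
        ((if 2 ^ j ∣ n then n * 2 ^ j else 0) + if 2 ^ (j + 1) ∣ n then 2 ^ j else 0) := by
  classical
  have : Fintype (Subgroup (ElemAb r)) := Fintype.ofFinite _
  have hcount (B : Subgroup (ElemAb r)) :=
    finite_and_card_sigma_index_mul_hom (elemAb_quotient_mul_self B) hn
  simp only [← Subgroup.index_eq_card] at hcount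
  have (B : Subgroup (ElemAb r)) := (hcount B).1
  rw [subgroupCount, Nat.card_congr (prodSubgroupEquiv n), Nat.card_sigma,
    Finset.sum_congr rfl fun B _ ↦ (hcount B).2]
  simp only [pow_succ]
  exact sum_subgroups_elemAb r fun q ↦
    (if q ∣ n then n * q else 0) + if q * 2 ∣ n then q else 0

end MainCount

theorem corollary5p1 (r : ℕ) :
    (∀ j : ℕ, j ≤ r →
      (subgroupCount (ElemAb r) (2 ^ j) : ℚ) =
        (∏ l ∈ Finset.range j, ((2 : ℚ) ^ r - 2 ^ l)) /
          (∏ l ∈ Finset.range j, ((2 : ℚ) ^ j - 2 ^ l))) ∧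
    ∀ n : ℕ, 1 ≤ n →
      subgroupCount (Cox (suspensionGraph r)) n =
        n * (1 + ∑ j ∈ Finset.Icc 1 r with 2 ^ j ∣ n,
              2 ^ j * subgroupCount (ElemAb r) (2 ^ j)) +
          ∑ j ∈ Finset.range (r + 1) with 2 ^ (j + 1) ∣ n,
            2 ^ j * subgroupCount (ElemAb r) (2 ^ j) := by
  refine ⟨fun j hj ↦ subgroupCount_elemAb hj, fun n hn ↦ ?_⟩
  have h0 : subgroupCount (ElemAb r) (2 ^ 0) = 1 := by
    have := subgroupCount_elemAb (r := r) (Nat.zero_le _)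
    simpa using this
  have hrange : Finset.range (r + 1) = insert 0 (Finset.Icc 1 r) := by
    ext j
    simp only [Finset.mem_range, Finset.mem_insert, Finset.mem_Icc]
    omega
  -- The `1` is the `j = 0` term, since `s_1 = 1` and `2 ^ 0 ∣ n`.
  have hsum : 1 + ∑ j ∈ Finset.Icc 1 r with 2 ^ j ∣ n, 2 ^ j * subgroupCount (ElemAb r) (2 ^ j) =
      ∑ j ∈ Finset.range (r + 1) with 2 ^ j ∣ n, 2 ^ j * subgroupCount (ElemAb r) (2 ^ j) := by
    rw [hrange, Finset.filter_insert, if_pos (by simp), Finset.sum_insert (by simp), h0]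
    simp
  rw [hsum, subgroupCount_congr (coxEquiv r),
    subgroupCount_elemAb_prod_dihedral r (Nat.one_le_iff_ne_zero.1 hn), Finset.sum_filter,
    Finset.sum_filter, Finset.mul_sum, ← Finset.sum_add_distrib]
  refine Finset.sum_congr rfl fun j _ ↦ ?_
  split_ifs <;> ring
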